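/- All ultrafilters are ultrafilters on $\omega$. A filter base for an ultrafilter $\mathcal U$ is a family $\mathcal B\subseteq\mathcal U$ such that every member of $\mathcal U$ contains a member of $\mathcal B$. A map $f:\mathcal U\to\mathcal V$ is cofinal if the image under $f$ of every filter base for $\mathcal U$ is a filter base for $\mathcal V$; $\mathcal V$ is Tukey reducible to $\mathcal U$, written $\mathcal V\le_T\mathcal U$, if there is a cofinal map from $\mathcal U$ to $\mathcal V$. A p-point is an ultrafilter $\mathcal W$ such that for each decreasing sequence $X_0\supseteq X_1\supseteq\cdots$ of members of $\mathcal W$ there is $A\in\mathcal W$ with $A\setminus X_n$ finite for all $n<\omega$. A q-point is a nonprincipal ultrafilter $\mathcal V$ such that for each partition of $\omega$ into finite sets there is a member of $\mathcal V$ that meets each piece of the partition in at most one point. Write $\mathcal V\le_{RB}\mathcal U$ if there is a finite-to-one map $h:\omega\to\omega$ such that $\mathcal V=h(\mathcal U)=\{Y\subseteq\omega : h^{-1}(Y)\in\mathcal U\}$. Theorem. Suppose that the ultrafilter $\mathcal U$ is Tukey reducible to some p-point. Then for every q-point $\mathcal V$, $\mathcal V\le_T\mathcal U$ implies $\mathcal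 V\le_{RB}\mathcal U$. -/

import Mathlib

namespace UltrafilterTukey

/-- `B` is a filter base for `U`: a family of members of `U` such that every member of `U`
contains a member of `B` (that is, `B` is cofinal in `U` ordered by reverse inclusion). -/
def IsFilterBase (U : Ultrafilter ℕ) (B : Set (Set ℕ)) : Prop :=
  (∀ X ∈ B, X ∈ U) ∧ ∀ X ∈ U, ∃ Y ∈ B, Y ⊆ X

/-- `f` restricts to a cofinal map from `U` to `V`: it sends members of `U` to members of `V`, and
the image of every filter base for `U` is a filter base for `V`. The values of `f` at sets which
are not members of `U` play no role. -/
def IsCofinalMap (U V : Ultrafilter ℕ) (f : Set ℕ → Set ℕ) : Prop :=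
  (∀ X ∈ U, f X ∈ V) ∧ ∀ B : Set (Set ℕ), IsFilterBase U B → IsFilterBase V (f '' B)

/-- Tukey reducibility `V ≤_T U`: there is a cofinal map from `U` to `V`. -/
def TukeyLE (V U : Ultrafilter ℕ) : Prop :=
  ∃ f : Set ℕ → Set ℕ, IsCofinalMap U V f

/-- Every point has only finitely many preimages. -/
def FiniteToOne (h : ℕ → ℕ) : Prop :=
  ∀ n : ℕ, (h ⁻¹' {n}).Finite

/-- Rudin-Blass reducibility `V ≤_RB U`: `V` is the image of `U` under a finite-to-one map. -/
def RudinBlassLE (V U : Ultrafilter ℕ) : Prop :=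
  ∃ h : ℕ → ℕ, FiniteToOne h ∧ U.map h = V

/-- p-points: every decreasing sequence of members of `U` has a pseudo-intersection in `U`. -/
def IsPPoint (U : Ultrafilter ℕ) : Prop :=
  ∀ X : ℕ → Set ℕ, Antitone X → (∀ n, X n ∈ U) → ∃ A ∈ U, ∀ n, (A \ X n).Finite

/-- q-points: nonprincipal ultrafilters `V` such that for every partition of `ℕ` into finite sets
(given as the fibers of a finite-to-one map) some member of `V` meets each piece in at most one
point. -/
def IsQPoint (V : Ultrafilter ℕ) : Prop :=
  (∀ n : ℕ, {n} ∉ V) ∧ ∀ h : ℕ → ℕ, FiniteToOne h → ∃ A ∈ V, Set.InjOn h A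

end UltrafilterTukey

namespace UltrafilterTukey

open Set

/-! Both `U` and `V` lie Tukey below one p-point `W`. Below some member of `W`, a monotone cofinal
map decides each output point from a finite part of its input, so members of `W` and of `U` (or `V`)
always have points within a bound of each other (`TukeyLE.exists_bound`). Cut ℕ into intervals
outgrowing the bounds: such points fall in the same or adjacent intervals, so the interval-index
images agree up to a shift (`exists_shift_map_eq`). Thus `U` and `V` share a finite-to-one image,
which the q-point property inverts on the side of `V`. -/

theorem IsCofinalMap.exists_monotone {U V : Ultrafilter ℕ} {f : Set ℕ → Set ℕ}
    (hf : IsCofinalMap U V f) :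
    ∃ φ : Set ℕ → Set ℕ, Monotone φ ∧ (∀ X ∈ U, φ X ∈ V) ∧ ∀ A ∈ V, ∃ X ∈ U, φ X ⊆ A := by
  have key : ∀ A : Set ℕ, ∃ X, A ∈ V → X ∈ U ∧ ∀ Y ∈ U, Y ⊆ X → f Y ⊆ A := by
    intro A
    by_cases hA : A ∈ V
    · by_contra! hcon
      have h : ∀ X ∈ U, ∃ Y ∈ U, Y ⊆ X ∧ ¬ f Y ⊆ A := fun X hX => (hcon X).2 hX
      have hbase : IsFilterBase U {Y | Y ∈ U ∧ ¬ f Y ⊆ A} :=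
        ⟨fun X hX => hX.1, fun X hX =>
          let ⟨Y, hY, hYX, hYA⟩ := h X hX
          ⟨Y, ⟨hY, hYA⟩, hYX⟩⟩
      obtain ⟨_, ⟨Y, hY, rfl⟩, hYA⟩ := (hf.2 _ hbase).2 A hA
      exact hY.2 hYA
    · exact ⟨∅, fun h => absurd h hA⟩
  choose g hg using key
  refine ⟨fun X => ⋂₀ {A | A ∈ V ∧ X ⊆ g A}, fun X Y hXY => ?_, fun X hX => ?_, fun A hA => ?_⟩
  · exact sInter_subset_sInter fun A hA => ⟨hA.1, hXY.trans hA.2⟩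
  · refine Filter.mem_of_superset (hf.1 X hX) (subset_sInter fun A hA => ?_)
    exact (hg A hA.1).2 X hX hA.2
  · exact ⟨g A, (hg A hA).1, sInter_subset_of_mem ⟨hA, Subset.rfl⟩⟩

theorem TukeyLE.trans {U V W : Ultrafilter ℕ} (hVU : TukeyLE V U) (hUW : TukeyLE U W) :
    TukeyLE V W := by
  obtain ⟨g, hg⟩ := hVU
  obtain ⟨f, hf⟩ := hUW
  refine ⟨g ∘ f, fun X hX => hg.1 _ (hf.1 X hX), fun B hB => ?_⟩
  rw [image_comp]
  exact hg.2 _ (hf.2 B hB)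

theorem TukeyLE.nonprincipal {U V : Ultrafilter ℕ} (h : TukeyLE V U) (hV : ∀ n : ℕ, {n} ∉ V) :
    ∀ n : ℕ, {n} ∉ U := by
  intro n hn
  obtain ⟨f, hf⟩ := h
  have hbase : IsFilterBase U {{n}} := by
    refine ⟨fun X hX => by rwa [mem_singleton_iff.1 hX], fun X hX => ⟨{n}, rfl, ?_⟩⟩
    obtain ⟨x, hx, rfl⟩ := U.nonempty_of_mem (Filter.inter_mem hX hn)
    simpa using hx
  obtain ⟨k, hk⟩ := V.nonempty_of_mem (hf.1 _ hn)
  obtain ⟨_, ⟨_, rfl, rfl⟩, hY⟩ :=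
    (hf.2 _ hbase).2 {k}ᶜ (Ultrafilter.compl_mem_iff_notMem.2 (hV k))
  exact hY hk rfl

theorem exists_strictMono_gt (g : ℕ → ℕ) :
    ∃ r : ℕ → ℕ, StrictMono r ∧ ∀ i, ∀ x ≤ r i, g x < r (i + 1) := by
  let G : ℕ → ℕ := fun n => n + 1 + ∑ i ∈ Finset.range (n + 1), g i
  have hG : ∀ n, ∀ x ≤ n, g x < G n := by
    intro n x hx
    have := Finset.single_le_sum (f := g) (fun _ _ => Nat.zero_le _)
      (Finset.mem_range.2 (show x < n + 1 by omega))
    simp only [G]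
    omega
  refine ⟨fun i => G^[i] 0, strictMono_nat_of_lt_succ fun i => ?_, fun i x hx => ?_⟩
  · rw [Function.iterate_succ_apply']
    simp only [G]
    omega
  · simp only [Function.iterate_succ_apply']
    exact hG _ x hx

theorem exists_interval_index {r : ℕ → ℕ} (hr : StrictMono r) :
    ∃ p : ℕ → ℕ, ∀ x i, p x ≤ i ↔ x < r i := by
  classical
  have h : ∀ x, ∃ i, x < r i := fun x => ⟨x + 1, lt_of_lt_of_le x.lt_succ_self (hr.id_le _)⟩
  refine ⟨fun x => Nat.find (h x), fun x i => ⟨fun hi => ?_, fun hi => Nat.find_min' _ hi⟩⟩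
  exact (Nat.find_spec (h x)).trans_le (hr.monotone hi)

/-- A pseudo-intersection enters `Y (r i)` one interval after `r i`. Keeping intervals of one parity
leaves that intermediate interval empty for every second `i`. -/
theorem IsPPoint.exists_diff_Iio_subset {W : Ultrafilter ℕ} (hW : IsPPoint W) {Y : ℕ → Set ℕ}
    (hY : Antitone Y) (hYW : ∀ n, Y n ∈ W) :
    ∃ C ∈ W, ∀ k, ∃ n ≥ k, C \ Iio n ⊆ Y n := by
  obtain ⟨A, hA, hfin⟩ := hW Y hY hYW
  choose β hβ using fun n => (hfin n).bddAbove
  obtain ⟨r, hr, hrβ⟩ := exists_strictMono_gt β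
  obtain ⟨p, hp⟩ := exists_interval_index hr
  have key : ∀ i, ∀ x ∈ A, i + 1 < p x → x ∈ Y (r i) := by
    intro i x hx hi
    by_contra hxY
    have h1 : x ≤ β (r i) := hβ (r i) ⟨hx, hxY⟩
    have h2 := hrβ i (r i) le_rfl
    exact absurd ((hp x (i + 1)).2 (h1.trans_lt h2)) (not_le.2 hi)
  have main : ∀ e, {x | p x % 2 = e % 2} ∈ W → ∃ C ∈ W, ∀ k, ∃ n ≥ k, C \ Iio n ⊆ Y n := by
    intro e he
    refine ⟨A ∩ {x | p x % 2 = e % 2}, Filter.inter_mem hA he, fun k => ?_⟩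
    refine ⟨r (2 * k + e), (show k ≤ 2 * k + e by omega).trans (hr.id_le _), ?_⟩
    rintro x ⟨⟨hxA, hxe⟩, hx⟩
    have h1 : ¬ p x ≤ 2 * k + e := fun h => hx ((hp _ _).1 h)
    refine key _ x hxA ?_
    simp only [mem_ofPred_eq] at hxe
    omega
  rcases W.mem_or_compl_mem {x | p x % 2 = 0 % 2} with h | h
  · exact main 0 h
  · refine main 1 (Filter.mem_of_superset h fun x hx => ?_)
    simp only [mem_compl_iff, mem_ofPred_eq] at hx ⊢
    omega

/-- Continuity of `f` below `C`: for each finite part `s`, one tail `T s k` keeps `k` out whenever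
some tail does, and `C` is eventually inside these tails. -/
theorem IsPPoint.exists_modulus {W : Ultrafilter ℕ} (hW : IsPPoint W) {f : Set ℕ → Set ℕ}
    (hf : Monotone f) :
    ∃ C ∈ W, ∃ m : ℕ → ℕ, ∀ k, ∀ Z ∈ W, Z ⊆ C → k ∉ f Z →
      k ∉ f ((Z ∩ Iio (m k)) ∪ (C \ Iio (m k))) := by
  classical
  have key : ∀ (s : Finset ℕ) (k : ℕ), ∃ T ∈ W, (∃ Z ∈ W, k ∉ f (↑s ∪ Z)) → k ∉ f (↑s ∪ T) := by
    intro s k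
    by_cases h : ∃ Z ∈ W, k ∉ f (↑s ∪ Z)
    · obtain ⟨Z, hZ, hk⟩ := h
      exact ⟨Z, hZ, fun _ => hk⟩
    · exact ⟨univ, Filter.univ_mem, fun h' => absurd h' h⟩
  choose T hTW hT using key
  let Y : ℕ → Set ℕ := fun n =>
    ⋂ s ∈ (Finset.range n).powerset, ⋂ k ∈ Finset.range (n + 1), T s k
  have hY : Antitone Y := by
    intro a b hab x hx
    simp only [Y, mem_iInter, Finset.mem_powerset, Finset.mem_range] at hx ⊢
    exact fun s hs k hk => hx s (hs.trans (Finset.range_mono hab)) k (by omega)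
  have hYW : ∀ n, Y n ∈ W := fun n =>
    (Filter.biInter_finset_mem _).2 fun s _ => (Filter.biInter_finset_mem _).2 fun k _ => hTW s k
  obtain ⟨C, hC, hCY⟩ := hW.exists_diff_Iio_subset hY hYW
  choose m hm hmC using hCY
  refine ⟨C, hC, m, fun k Z hZ _ hk => ?_⟩
  obtain ⟨s, hs⟩ := ((finite_Iio (m k)).inter_of_right Z).exists_finset_coe
  rw [← hs]
  have h1 : k ∉ f (↑s ∪ T s k) := by
    refine hT s k ⟨Z, hZ, ?_⟩
    rwa [hs, union_eq_self_of_subset_left inter_subset_left]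
  refine fun h2 => h1 (hf (union_subset_union_right _ fun x hx => ?_) h2)
  have hx' := hmC k hx
  simp only [Y, mem_iInter, Finset.mem_powerset, Finset.mem_range] at hx'
  refine hx' s (fun y hy => ?_) k (Nat.lt_succ_of_le (hm k))
  have : y ∈ Z ∩ Iio (m k) := hs ▸ Finset.mem_coe.2 hy
  exact Finset.mem_range.2 this.2

/-- A nonprincipal ultrafilter that is Tukey below a p-point is close to it: some function bounds
the distance between any two of their members. -/
theorem TukeyLE.exists_bound {U W : Ultrafilter ℕ} (hW : IsPPoint W) (hU : ∀ n : ℕ, {n} ∉ U)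
    (h : TukeyLE U W) :
    ∃ g : ℕ → ℕ, ∀ A ∈ W, ∀ X ∈ U, ∃ a ∈ A, ∃ x ∈ X, a ≤ g x ∧ x ≤ g a := by
  classical
  obtain ⟨_, hf₀⟩ := h
  obtain ⟨f, hf, hfU, hcof⟩ := hf₀.exists_monotone
  obtain ⟨C, hC, m, hm⟩ := hW.exists_modulus hf
  -- `ψ s` is the set of outputs forced by `s`.
  let ψ : Set ℕ → Set ℕ := fun s => {k | ∀ Z ∈ W, Z ⊆ C → s ⊆ Z → k ∈ f Z}
  have hψ : ∀ A ∈ W, A ⊆ C → ∀ k ∈ f A, k ∈ ψ (A ∩ Iio (m k)) := by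
    intro A _ hAC k hk Z hZ hZC hAZ
    by_contra hkZ
    have hZ' : (A ∩ Iio (m k)) ∪ (Z \ Iio (m k)) ∈ W := by
      refine Filter.mem_of_superset (Filter.inter_mem ‹A ∈ W› hZ) fun x hx => ?_
      by_cases hxm : x ∈ Iio (m k)
      · exact Or.inl ⟨hx.1, hxm⟩
      · exact Or.inr ⟨hx.2, hxm⟩
    have hsub : (A ∩ Iio (m k)) ∪ (Z \ Iio (m k)) ⊆ Z := union_subset hAZ sdiff_subset
    refine hm k _ hZ' (hsub.trans hZC) (fun h => hkZ (hf hsub h)) (hf (fun x hx => ?_) hk)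
    by_cases hxm : x ∈ Iio (m k)
    · exact Or.inl ⟨Or.inl ⟨hx, hxm⟩, hxm⟩
    · exact Or.inr ⟨hAC hx, hxm⟩
  have hempty : ∀ k, k ∉ ψ ∅ := by
    intro k hk
    obtain ⟨A, hA, hAk⟩ := hcof {k}ᶜ (Ultrafilter.compl_mem_iff_notMem.2 (hU k))
    exact hAk (hf inter_subset_left
      (hk (A ∩ C) (Filter.inter_mem hA hC) inter_subset_right (empty_subset _))) rfl
  let c : ℕ → ℕ := fun n => (Finset.range (n + 1)).powerset.sup fun s => sInf (ψ ↑s)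
  refine ⟨fun n => max (m n) (c n), fun A hA X hX => ?_⟩
  obtain ⟨B, hB, hBX⟩ := hcof X hX
  have hD : A ∩ B ∩ C ∈ W := Filter.inter_mem (Filter.inter_mem hA hB) hC
  set D := A ∩ B ∩ C with hDdef
  have hDC : D ⊆ C := inter_subset_right
  -- The first initial segment of `D` forcing anything ends at some `a ∈ D`. Its least forced `k`
  -- has `a < m k` by minimality and `k ≤ c a` by the choice of `c`.
  have hex : ∃ n, (ψ (D ∩ Iio n)).Nonempty := by
    obtain ⟨k, hk⟩ := U.nonempty_of_mem (hfU D hD)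
    exact ⟨m k, k, hψ D hD hDC k hk⟩
  obtain ⟨n, hn⟩ : ∃ n, n = Nat.find hex := ⟨_, rfl⟩
  have hne : (ψ (D ∩ Iio n)).Nonempty := hn ▸ Nat.find_spec hex
  have hmin : ∀ j, (ψ (D ∩ Iio j)).Nonempty → n ≤ j := fun j hj => hn ▸ Nat.find_min' hex hj
  cases n with
  | zero =>
    obtain ⟨k, hk⟩ := hne
    exact absurd (by simpa using hk) (hempty k)
  | succ a =>
    have ha : a ∈ D := by
      by_contra ha
      have : D ∩ Iio (a + 1) = D ∩ Iio a := by
        ext x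
        simp only [mem_inter_iff, mem_Iio]
        refine ⟨fun hx => ⟨hx.1, ?_⟩, fun hx => ⟨hx.1, by omega⟩⟩
        have : x ≠ a := fun h => ha (h ▸ hx.1)
        omega
      have := hmin a (this ▸ hne)
      omega
    have hk := Nat.sInf_mem hne
    set k := sInf (ψ (D ∩ Iio (a + 1))) with hkdef
    have hkD : k ∈ f D := hk D hD hDC inter_subset_left
    have hle := hmin _ ⟨k, hψ D hD hDC k hkD⟩
    refine ⟨a, ha.1.1, k, hBX (hf (fun x hx => hx.1.2) hkD), le_max_of_le_left (by omega),
      le_max_of_le_right ?_⟩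
    obtain ⟨s, hs⟩ := ((finite_Iio (a + 1)).inter_of_right D).exists_finset_coe
    rw [hkdef, ← hs]
    refine Finset.le_sup (f := fun s : Finset ℕ => sInf (ψ ↑s)) (Finset.mem_powerset.2 fun y hy => ?_)
    have : y ∈ D ∩ Iio (a + 1) := hs ▸ Finset.mem_coe.2 hy
    exact Finset.mem_range.2 this.2

theorem exists_mem_notMem_of_ne {U V : Ultrafilter ℕ} (h : U ≠ V) : ∃ S ∈ U, S ∉ V := by
  by_contra! hcon
  exact h (Ultrafilter.coe_le_coe.1 fun S hS => by
    by_contra hSU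
    exact Ultrafilter.compl_mem_iff_notMem.1 (hcon _ (Ultrafilter.compl_mem_iff_notMem.2 hSU)) hS)

/-- Shifts (0,0), (1,0), (0,1) suffice: sets separating all three pairs would rule out every
possible difference of `p a` and `p x`. -/
theorem exists_shift_map_eq {U W : Ultrafilter ℕ} {p : ℕ → ℕ}
    (h : ∀ A ∈ W, ∀ X ∈ U, ∃ a ∈ A, ∃ x ∈ X, p a ≤ p x + 1 ∧ p x ≤ p a + 1) :
    ∃ i j : ℕ, U.map (fun n => p n + i) = W.map fun n => p n + j := by
  by_contra! hcon
  obtain ⟨S₁, hU₁, hW₁⟩ := exists_mem_notMem_of_ne (hcon 0 0)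
  obtain ⟨S₂, hU₂, hW₂⟩ := exists_mem_notMem_of_ne (hcon 1 0)
  obtain ⟨S₃, hU₃, hW₃⟩ := exists_mem_notMem_of_ne (hcon 0 1)
  rw [Ultrafilter.mem_map] at hU₁ hU₂ hU₃
  rw [Ultrafilter.mem_map, ← Ultrafilter.compl_mem_iff_notMem] at hW₁ hW₂ hW₃
  obtain ⟨a, ⟨⟨ha₁, ha₂⟩, ha₃⟩, x, ⟨⟨hx₁, hx₂⟩, hx₃⟩, hax, hxa⟩ :=
    h _ (Filter.inter_mem (Filter.inter_mem hW₁ hW₂) hW₃)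
      _ (Filter.inter_mem (Filter.inter_mem hU₁ hU₂) hU₃)
  simp only [mem_compl_iff, mem_preimage, add_zero] at ha₁ ha₂ ha₃ hx₁ hx₂ hx₃
  obtain h' | h' | h' : p a = p x ∨ p a = p x + 1 ∨ p x = p a + 1 := by omega
  · exact ha₁ (h' ▸ hx₁)
  · exact ha₂ (h' ▸ hx₂)
  · exact ha₃ (h' ▸ hx₃)

theorem FiniteToOne.comp {g h : ℕ → ℕ} (hg : FiniteToOne g) (hh : FiniteToOne h) :
    FiniteToOne (g ∘ h) := by
  intro n
  rw [preimage_comp, ← biUnion_preimage_singleton h]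
  exact (hg n).biUnion fun k _ => hh k

theorem FiniteToOne.add_const {p : ℕ → ℕ} (hp : FiniteToOne p) (i : ℕ) :
    FiniteToOne fun n => p n + i := by
  refine FiniteToOne.comp (g := fun n => n + i) (fun n => ?_) hp
  exact (finite_singleton n).preimage (add_left_injective i).injOn

theorem IsQPoint.rudinBlassLE_of_map_eq {U V : Ultrafilter ℕ} (hV : IsQPoint V) {p q : ℕ → ℕ}
    (hp : FiniteToOne p) (hq : FiniteToOne q) (h : U.map p = V.map q) : RudinBlassLE V U := by
  classical
  obtain ⟨A, hA, hinj⟩ := hV.2 q hq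
  -- The identity off `q '' A` keeps `g` finite-to-one.
  let g : ℕ → ℕ := fun n => if n ∈ q '' A then Function.invFunOn q A n else n
  have hgq : ∀ a ∈ A, g (q a) = a := fun a ha => by
    simp only [g, if_pos (mem_image_of_mem q ha)]
    exact hinj.leftInvOn_invFunOn ha
  have hg : FiniteToOne g := by
    refine fun n => (toFinite {q n, n}).subset fun k hk => ?_
    by_cases hkA : k ∈ q '' A
    · obtain ⟨a, ha, rfl⟩ := hkA
      rw [mem_preimage, hgq a ha, mem_singleton_iff] at hk
      exact Or.inl (by rw [hk])
    · have hgk : g k = k := if_neg hkA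
      rw [mem_preimage, hgk] at hk
      exact Or.inr hk
  refine ⟨g ∘ p, hg.comp hp, ?_⟩
  rw [← Ultrafilter.map_map, h, Ultrafilter.map_map]
  refine Ultrafilter.coe_injective ?_
  rw [Ultrafilter.coe_map]
  refine (Filter.map_congr (Filter.mem_of_superset hA fun a ha => ?_)).trans Filter.map_id
  exact hgq a ha

end UltrafilterTukey

theorem theorem2p7 (U : Ultrafilter ℕ)
    (hU : ∃ W : Ultrafilter ℕ, UltrafilterTukey.IsPPoint W ∧ UltrafilterTukey.TukeyLE U W) :
    ∀ V : Ultrafilter ℕ, UltrafilterTukey.IsQPoint V → UltrafilterTukey.TukeyLE V U →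
      UltrafilterTukey.RudinBlassLE V U := by
  open UltrafilterTukey in
  intro V hV hVU
  obtain ⟨W, hW, hUW⟩ := hU
  obtain ⟨g₁, hg₁⟩ := hUW.exists_bound hW (hVU.nonprincipal hV.1)
  obtain ⟨g₂, hg₂⟩ := (hVU.trans hUW).exists_bound hW hV.1
  obtain ⟨r, hr, hrg⟩ := exists_strictMono_gt fun n => max (g₁ n) (g₂ n)
  obtain ⟨p, hp⟩ := exists_interval_index hr
  have hpfin : FiniteToOne p := fun n =>
    (Set.finite_Iio (r n)).subset fun x hx => (hp x n).1 (le_of_eq hx)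
  have hclose : ∀ x y, y ≤ max (g₁ x) (g₂ x) → p y ≤ p x + 1 := fun x y hxy =>
    (hp y _).2 (hxy.trans_lt (hrg (p x) x ((hp x _).1 le_rfl).le))
  obtain ⟨i, j, hij⟩ := exists_shift_map_eq (U := U) (W := W) (p := p) fun A hA X hX =>
    let ⟨a, ha, x, hx, h₁, h₂⟩ := hg₁ A hA X hX
    ⟨a, ha, x, hx, hclose x a (le_max_of_le_left h₁), hclose a x (le_max_of_le_left h₂)⟩
  obtain ⟨k, l, hkl⟩ := exists_shift_map_eq (U := V) (W := W) (p := p) fun A hA X hX =>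
    let ⟨a, ha, x, hx, h₁, h₂⟩ := hg₂ A hA X hX
    ⟨a, ha, x, hx, hclose x a (le_max_of_le_right h₁), hclose a x (le_max_of_le_right h₂)⟩
  refine hV.rudinBlassLE_of_map_eq (hpfin.add_const (i + l)) (hpfin.add_const (k + j)) ?_
  have e₁ := congrArg (Ultrafilter.map (· + l)) hij
  have e₂ := congrArg (Ultrafilter.map (· + j)) hkl
  simp only [Ultrafilter.map_map, Function.comp_def, add_assoc] at e₁ e₂
  rw [e₁, e₂, add_comm j l]
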